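/- Consider the linear time-invariant system $\dot x = Ax + \acute B\acute u + \bar B\bar u$, $y = Cx$ on $[0,\infty)$, with real matrices $A\in\mathbb R^{n\times n}$, $\acute B\in\mathbb R^{n\times l}$, $\bar B\in\mathbb R^{n\times q}$, $C\in\mathbb R^{p\times n}$, known input $\acute u$ and unknown input $\bar u$. For $L\in\mathbb R^{n\times p}$ put $A_L = A+LC$. Let $\mathbb C_g=\{\mu\in\mathbb C:\operatorname{Re}\mu<0\}$. Consider the family of all subspaces $\mathscr W\subseteq\mathbb R^n$ that contain $\operatorname{Im}\bar B$ and for which some $L$ satisfies $A_L\mathscr W\subseteq\mathscr W$ (so that $\mathscr W$ is $(C,A)$-invariant) and the spectrum of the induced map $A_L|\mathbb R^n/\mathscr W$ lies in $\mathbb C_g$. This family has a least element $\mathscr W_g^*$, the intersection of its members. Let $k = n-\dim\mathscr W_g^*$, let $P\in\mathbb R^{k\times n}$ be the matrix of the canonical projection $\mathbb R^n\to\mathbb R^n/\mathscr W_g^*$ in any basis of the quotient, let $L$ be any matrix with $A_L\mathscr W_g^*\subseteq\mathscr W_g^*$ such that the spectrum of $A_L|\mathbb R^n/\mathscr W_g^*$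 lies in $\mathbb C_g$, and let $\bar{\bar A}_L$ be the matrix of this induced map in the same basis. For $E\in\mathbb R^{n\times k}$ and $F\in\mathbb R^{n\times p}$ consider the observer $$\dot z = \bar{\bar A}_L z + P\acute B\acute u - PLy,\qquad \hat x = Ez+Fy .$$ It is called a centralized unknown input observer (UIO) if $\lim_{t\to\infty}\|x(t)-\hat x(t)\| = 0$ for all locally integrable inputs $\acute u,\bar u$ and all initial values $x(0), z(0)$. Then there are $E, F$ for which the observer is a centralized UIO if and only if $\mathscr W_g^*\cap\operatorname{Ker}C = 0$. Moreover, if $\mathscr W_g^*\cap\operatorname{Ker}C=0$, then there are $E,F$ with $EP+FC=I_n$; and whenever $EP+FC=I_n$, the observer with these $E,F$ is a centralized UIO. -/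

import Mathlib

open scoped Matrix Topology

noncomputable section

namespace Observer

/-- `A_L = A + L C`, as an endomorphism of the state space `ℝⁿ`. -/
def injected {n p : ℕ} (A : Matrix (Fin n) (Fin n) ℝ) (C : Matrix (Fin p) (Fin n) ℝ)
    (L : Matrix (Fin n) (Fin p) ℝ) : (Fin n → ℝ) →ₗ[ℝ] (Fin n → ℝ) :=
  Matrix.toLin' (A + L * C)

/-- `(A + L C) W ⊆ W`. The subspace `W` is `(C, A)`-invariant if some `L` has this property. -/
def Renders {n p : ℕ} (A : Matrix (Fin n) (Fin n) ℝ) (C : Matrix (Fin p) (Fin n) ℝ)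
    (L : Matrix (Fin n) (Fin p) ℝ) (W : Submodule ℝ (Fin n → ℝ)) : Prop :=
  W ≤ W.comap (injected A C L)

/-- The induced map `A_L | (ℝⁿ / W)`. -/
def induced {n p : ℕ} (A : Matrix (Fin n) (Fin n) ℝ) (C : Matrix (Fin p) (Fin n) ℝ)
    (L : Matrix (Fin n) (Fin p) ℝ) (W : Submodule ℝ (Fin n → ℝ)) (h : Renders A C L W) :
    ((Fin n → ℝ) ⧸ W) →ₗ[ℝ] ((Fin n → ℝ) ⧸ W) :=
  W.mapQ W (injected A C L) h

/-- The good region of the complex plane: the open left half-plane. -/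
def good : Set ℂ := {μ | μ.re < 0}

/-- `L` renders `W` invariant and the complex spectrum of the induced map on `ℝⁿ / W`
(the complex roots of its characteristic polynomial) lies in the good region. -/
def Admissible {n p : ℕ} (A : Matrix (Fin n) (Fin n) ℝ) (C : Matrix (Fin p) (Fin n) ℝ)
    (L : Matrix (Fin n) (Fin p) ℝ) (W : Submodule ℝ (Fin n → ℝ)) : Prop :=
  ∃ h : Renders A C L W, (induced A C L W h).charpoly.rootSet ℂ ⊆ good

/-- The `(C, A)`-invariant subspaces `W` that contain the image of `B₂` and for which the spectrum
of the induced map on `ℝⁿ / W` can be placed in the good region by output injection. -/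
def family {n q p : ℕ} (A : Matrix (Fin n) (Fin n) ℝ) (B₂ : Matrix (Fin n) (Fin q) ℝ)
    (C : Matrix (Fin p) (Fin n) ℝ) : Set (Submodule ℝ (Fin n → ℝ)) :=
  {W | LinearMap.range (Matrix.toLin' B₂) ≤ W ∧ ∃ L : Matrix (Fin n) (Fin p) ℝ, Admissible A C L W}

/-- The infimal element `W_g*` of the family. -/
def Wg {n q p : ℕ} (A : Matrix (Fin n) (Fin n) ℝ) (B₂ : Matrix (Fin n) (Fin q) ℝ)
    (C : Matrix (Fin p) (Fin n) ℝ) : Submodule ℝ (Fin n → ℝ) :=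
  sInf (family A B₂ C)

/-- The matrix of the canonical projection `ℝⁿ → ℝⁿ / W` with respect to the standard basis of
`ℝⁿ` and a basis `b` of the quotient. -/
def projMatrix {n k : ℕ} (W : Submodule ℝ (Fin n → ℝ))
    (b : Module.Basis (Fin k) ℝ ((Fin n → ℝ) ⧸ W)) : Matrix (Fin k) (Fin n) ℝ :=
  LinearMap.toMatrix (Pi.basisFun ℝ (Fin n)) b W.mkQ

/-- The matrix of the induced map `A_L | (ℝⁿ / W)` in a basis `b` of the quotient. -/
def inducedMatrix {n p k : ℕ} (A : Matrix (Fin n) (Fin n) ℝ) (C : Matrix (Fin p) (Fin n) ℝ)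
    (L : Matrix (Fin n) (Fin p) ℝ) (W : Submodule ℝ (Fin n → ℝ))
    (b : Module.Basis (Fin k) ℝ ((Fin n → ℝ) ⧸ W)) (h : Renders A C L W) :
    Matrix (Fin k) (Fin k) ℝ :=
  LinearMap.toMatrix b b (induced A C L W h)

/-- `x` solves `ẋ = f` on `[0, ∞)` in the sense of Carathéodory. -/
def Solves {k : ℕ} (x f : ℝ → Fin k → ℝ) : Prop :=
  ∀ t : ℝ, 0 ≤ t → IntervalIntegrable f MeasureTheory.volume 0 t ∧
    x t = x 0 + ∫ s in (0 : ℝ)..t, f s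

/-- For the plant `ẋ = A x + B₁ u₁ + B₂ u₂`, `y = C x`, the observer `ż = N z + G u₁ + H y`,
`x̂ = E z + F y` is a centralized unknown input observer: the estimation error tends to zero for
all locally integrable known inputs `u₁` and unknown inputs `u₂` and all initial values of the
plant and of the observer. -/
def IsUnknownInputObserver {n l q p k : ℕ} (A : Matrix (Fin n) (Fin n) ℝ)
    (B₁ : Matrix (Fin n) (Fin l) ℝ) (B₂ : Matrix (Fin n) (Fin q) ℝ) (C : Matrix (Fin p) (Fin n) ℝ)
    (N : Matrix (Fin k) (Fin k) ℝ) (G : Matrix (Fin k) (Fin l) ℝ) (H : Matrix (Fin k) (Fin p) ℝ)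
    (E : Matrix (Fin n) (Fin k) ℝ) (F : Matrix (Fin n) (Fin p) ℝ) : Prop :=
  ∀ (u₁ : ℝ → Fin l → ℝ) (u₂ : ℝ → Fin q → ℝ) (x : ℝ → Fin n → ℝ) (z : ℝ → Fin k → ℝ),
    MeasureTheory.LocallyIntegrableOn u₁ (Set.Ici 0) →
    MeasureTheory.LocallyIntegrableOn u₂ (Set.Ici 0) →
    Solves x (fun t => A *ᵥ x t + B₁ *ᵥ u₁ t + B₂ *ᵥ u₂ t) →
    Solves z (fun t => N *ᵥ z t + G *ᵥ u₁ t + H *ᵥ (C *ᵥ x t)) →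
    Filter.Tendsto (fun t => ‖x t - (E *ᵥ z t + F *ᵥ (C *ᵥ x t))‖) Filter.atTop (𝓝 0)

end Observer

end

/-! The starting point is a description of admissible subspaces that does not mention `L`. On `Ker
C` the maps `A_L` and `A` agree, so if some `L` works for `W`, then `A` maps `W ∩ Ker C` into `W`,
and no vector of `Ker C` outside `W` is an eigenvector of `A` modulo `W` with `Re μ ≥ 0` (complex
vectors being read as real pairs). `exists_admissible_iff` shows that these two conditions suffice.
Both pass to intersections, which gives the least element.

Sufficiency of `W_g* ∩ Ker C = 0`: the stacked matrix of `P` and `C` is then injective, and the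
blocks of a left inverse are `E` and `F`. With `e = z - P x`, the intertwining `N P = P (A + L C)`
and `P B₂ = 0` give `ė = N e` for every input, so `e → 0`; when `E P + F C = 1` the estimation error
is `-E e`.

Necessity: the observer can be started at `z(0) = P x(0)`, so that `z = P x` throughout and the
error is `R x` with `R = 1 - E P - F C`. Hence `R x → 0` along all plant trajectories with `u₁ = 0`
and continuous `u₂`. This puts the unobservable subspace of `(R, A)` in the family: exponential
inputs show that it contains `Im B₂`, free motions that no unstable eigenvalue remains modulo it. So
`R` vanishes on `W_g*` (`mulVec_eq_zero_of_mem_Wg`), while `R w = w` for `w` in `W_g* ∩ Ker C`. -/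

namespace Observer

/-! ### Complex eigenvalues of real endomorphisms -/

/-- `u + i v` is an eigenvector of `T` (or zero) with eigenvalue `μ`, in real terms. -/
def IsEigenPair {X : Type*} [AddCommGroup X] [Module ℝ X] (T : X →ₗ[ℝ] X) (μ : ℂ) (u v : X) :
    Prop :=
  T u = μ.re • u - μ.im • v ∧ T v = μ.im • u + μ.re • v

/-- Real and imaginary parts of a complex eigenvector of the coordinate matrix give the pair. This
form descends to quotients and restricts to kernels without complexifying the spaces. -/
theorem mem_rootSet_charpoly_iff {X : Type*} [AddCommGroup X] [Module ℝ X]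
    [FiniteDimensional ℝ X] (T : X →ₗ[ℝ] X) (μ : ℂ) :
    μ ∈ T.charpoly.rootSet ℂ ↔ ∃ u v : X, ¬(u = 0 ∧ v = 0) ∧ IsEigenPair T μ u v := by
  let b := Module.finBasis ℝ X
  let M := LinearMap.toMatrix b b T
  have hroot : μ ∈ T.charpoly.rootSet ℂ ↔
      ∃ w : Fin (Module.finrank ℝ X) → ℂ, w ≠ 0 ∧ (M.map (algebraMap ℝ ℂ)) *ᵥ w = μ • w := by
    rw [Polynomial.mem_rootSet_of_ne (LinearMap.charpoly_monic T).ne_zero,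
      ← LinearMap.charpoly_toMatrix T b, Polynomial.aeval_def, ← Polynomial.eval_map,
      ← Matrix.charpoly_map, Matrix.eval_charpoly, ← Matrix.exists_mulVec_eq_zero_iff]
    refine exists_congr fun w => and_congr_right fun _ => ?_
    rw [Matrix.sub_mulVec, sub_eq_zero, eq_comm]
    simp [M, Matrix.scalar_apply, ← Matrix.smul_one_eq_diagonal, Matrix.smul_mulVec]
  have hT : ∀ x : X, b.equivFun (T x) = M *ᵥ b.equivFun x := fun x => by
    simpa using (LinearMap.toMatrix_mulVec_repr b b T x).symm
  rw [hroot]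
  constructor
  · rintro ⟨w, hw, h⟩
    have hre : M *ᵥ (fun i => (w i).re) = μ.re • (fun i => (w i).re) - μ.im • fun i => (w i).im := by
      ext i
      have := congrArg Complex.re (congrFun h i)
      simpa [Matrix.mulVec, dotProduct, Complex.re_sum] using this
    have him : M *ᵥ (fun i => (w i).im) = μ.im • (fun i => (w i).re) + μ.re • fun i => (w i).im := by
      ext i
      have := congrArg Complex.im (congrFun h i)
      simpa [Matrix.mulVec, dotProduct, Complex.im_sum, add_comm] using this
    refine ⟨b.equivFun.symm fun i => (w i).re, b.equivFun.symm fun i => (w i).im, ?_, ?_, ?_⟩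
    · rintro ⟨h1, h2⟩
      rw [LinearEquiv.map_eq_zero_iff] at h1 h2
      exact hw (funext fun i => Complex.ext (congrFun h1 i) (congrFun h2 i))
    · apply b.equivFun.injective
      rw [hT, LinearEquiv.apply_symm_apply, hre]
      simp only [map_sub, map_smul, LinearEquiv.apply_symm_apply]
    · apply b.equivFun.injective
      rw [hT, LinearEquiv.apply_symm_apply, him]
      simp only [map_add, map_smul, LinearEquiv.apply_symm_apply]
  · rintro ⟨u, v, h0, hu, hv⟩
    have hu' := congrArg b.equivFun hu
    have hv' := congrArg b.equivFun hv
    rw [hT] at hu' hv'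
    simp only [map_sub, map_add, map_smul] at hu' hv'
    refine ⟨fun i => ⟨b.equivFun u i, b.equivFun v i⟩, fun h => h0 ⟨?_, ?_⟩, ?_⟩
    · apply b.equivFun.injective
      ext i
      simpa using congrArg Complex.re (congrFun h i)
    · apply b.equivFun.injective
      ext i
      simpa using congrArg Complex.im (congrFun h i)
    · ext i
      apply Complex.ext
      · have := congrFun hu' i
        simpa [Matrix.mulVec, dotProduct, Complex.re_sum] using this
      · have := congrFun hv' i
        simpa [Matrix.mulVec, dotProduct, Complex.im_sum, add_comm] using this

theorem rootSet_subset_good_iff {X : Type*} [AddCommGroup X] [Module ℝ X]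
    [FiniteDimensional ℝ X] (T : X →ₗ[ℝ] X) :
    T.charpoly.rootSet ℂ ⊆ good ↔
      ∀ (μ : ℂ) (u v : X), 0 ≤ μ.re → IsEigenPair T μ u v → u = 0 ∧ v = 0 := by
  constructor
  · intro h μ u v hμ huv
    by_contra h0
    exact absurd (h ((mem_rootSet_charpoly_iff T μ).2 ⟨u, v, h0, huv⟩)) (not_lt.2 hμ)
  · intro h μ hμ
    obtain ⟨u, v, h0, huv⟩ := (mem_rootSet_charpoly_iff T μ).1 hμ
    by_contra hb
    exact h0 (h μ u v (not_lt.1 hb) huv)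

/-! ### Stabilization of detectable pairs by output injection -/

/-- A linear map that vanishes wherever `f` does factors through `f`. -/
theorem exists_comp_eq_of_ker_le {K U V Z : Type*} [Field K] [AddCommGroup U] [Module K U]
    [AddCommGroup V] [Module K V] [AddCommGroup Z] [Module K Z] (f : U →ₗ[K] V) (g : U →ₗ[K] Z)
    (h : LinearMap.ker f ≤ LinearMap.ker g) : ∃ r : V →ₗ[K] Z, r ∘ₗ f = g := by
  obtain ⟨r, hr⟩ := LinearMap.exists_extend
    ((LinearMap.ker f).liftQ g h ∘ₗ f.quotKerEquivRange.symm.toLinearMap)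
  refine ⟨r, LinearMap.ext fun x => ?_⟩
  have := LinearMap.congr_fun hr ⟨f x, x, rfl⟩
  simp only [LinearMap.comp_apply, Submodule.subtype_apply, LinearEquiv.coe_coe] at this
  rw [LinearMap.comp_apply, this]
  have h2 : f.quotKerEquivRange.symm ⟨f x, x, rfl⟩ = (LinearMap.ker f).mkQ x := by
    rw [LinearEquiv.symm_apply_eq]; rfl
  rw [h2]; simp

/-- The fundamental matrix of `ẋ = A x`. -/
theorem exists_flow {n : ℕ} (A : Matrix (Fin n) (Fin n) ℝ) :
    ∃ Φ : ℝ → Matrix (Fin n) (Fin n) ℝ, Φ 0 = 1 ∧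
      (∀ t x, HasDerivAt (fun s => Φ s *ᵥ x) (A *ᵥ (Φ t *ᵥ x)) t) ∧
      ∀ t, A * Φ t = Φ t * A := by
  let _ : NormedRing (Matrix (Fin n) (Fin n) ℝ) := Matrix.linftyOpNormedRing
  let _ : NormedAlgebra ℝ (Matrix (Fin n) (Fin n) ℝ) := Matrix.linftyOpNormedAlgebra
  have hcomm : ∀ t : ℝ, A * NormedSpace.exp (t • A) = NormedSpace.exp (t • A) * A := fun t =>
    (((Commute.refl A).smul_right t).exp_right).eq
  let ev (x : Fin n → ℝ) : Matrix (Fin n) (Fin n) ℝ →L[ℝ] (Fin n → ℝ) :=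
    LinearMap.toContinuousLinearMap
      { toFun := fun M => M *ᵥ x
        map_add' := fun M N => Matrix.add_mulVec M N x
        map_smul' := fun c M => Matrix.smul_mulVec c M x }
  refine ⟨fun t => NormedSpace.exp (t • A), by simp, fun t x => ?_, hcomm⟩
  have h := (ev x).hasFDerivAt.comp_hasDerivAt t (hasDerivAt_exp_smul_const' A t)
  rw [Matrix.mulVec_mulVec]
  exact h

/-- The finite-horizon observability Gramian of `(C, -A)`. -/
theorem exists_gramian {n m : ℕ} (A : Matrix (Fin n) (Fin n) ℝ) (C : Matrix (Fin m) (Fin n) ℝ) :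
    ∃ P : Matrix (Fin n) (Fin n) ℝ, Pᵀ = P ∧ (∀ x, 0 ≤ x ⬝ᵥ P *ᵥ x) ∧
      (∀ x, P *ᵥ x = 0 → C *ᵥ x = 0) ∧
      ∀ x, 2 * (x ⬝ᵥ P *ᵥ (A *ᵥ x)) ≤ (C *ᵥ x) ⬝ᵥ (C *ᵥ x) := by
  -- The flow runs backwards so that `2 xᵀ P A x` equals `|C x|²` minus the value of `|g x|²` at
  -- time 1; dropping that term gives the inequality.
  obtain ⟨Φ, h0, hd, hc⟩ := exists_flow (-A)
  let g (x : Fin n → ℝ) (t : ℝ) : Fin m → ℝ := C *ᵥ (Φ t *ᵥ x)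
  have hg0 : ∀ x, g x 0 = C *ᵥ x := fun x => by simp [g, h0]
  have hgd : ∀ x t, HasDerivAt (g x) (-(g (A *ᵥ x) t)) t := by
    intro x t
    have h := (Matrix.toLin' C).toContinuousLinearMap.hasFDerivAt.comp_hasDerivAt t (hd t x)
    have e : -(g (A *ᵥ x) t) = C *ᵥ (-A *ᵥ (Φ t *ᵥ x)) := by
      rw [Matrix.mulVec_mulVec x (-A), hc]
      simp [g, Matrix.mulVec_neg, Matrix.neg_mulVec, Matrix.mul_assoc]
    rw [e]
    exact h
  have hgc : ∀ x, Continuous (g x) := fun x =>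
    continuous_iff_continuousAt.2 fun t => (hgd x t).continuousAt
  have hdot : ∀ x y, Continuous fun t => g x t ⬝ᵥ g y t := fun x y => (hgc x).dotProduct (hgc y)
  let P : Matrix (Fin n) (Fin n) ℝ := Matrix.of fun i j =>
    ∫ t in (0 : ℝ)..1, g (Pi.single i 1) t ⬝ᵥ g (Pi.single j 1) t
  have hsum : ∀ x t, g x t = ∑ i, x i • g (Pi.single i 1) t := by
    intro x t
    conv_lhs => rw [pi_eq_sum_univ' x]
    simp only [g, Matrix.mulVec_sum, Matrix.mulVec_smul]
  have hP : ∀ x y, x ⬝ᵥ P *ᵥ y = ∫ t in (0 : ℝ)..1, g x t ⬝ᵥ g y t := by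
    intro x y
    have e : ∀ t, g x t ⬝ᵥ g y t =
        ∑ i, ∑ j, x i * (y j * (g (Pi.single i 1) t ⬝ᵥ g (Pi.single j 1) t)) := by
      intro t
      rw [hsum x, hsum y]
      simp only [sum_dotProduct, dotProduct_sum, smul_dotProduct, dotProduct_smul, smul_eq_mul,
        Finset.mul_sum]
      rw [Finset.sum_comm]
      exact Finset.sum_congr rfl fun i _ => Finset.sum_congr rfl fun j _ => by ring
    simp only [e]
    have hcc : ∀ i j, Continuous fun t =>
        x i * (y j * (g (Pi.single i 1) t ⬝ᵥ g (Pi.single j 1) t)) := fun i j =>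
      continuous_const.mul (continuous_const.mul (hdot _ _))
    rw [intervalIntegral.integral_finsetSum fun i _ =>
      (continuous_finsetSum _ fun j _ => hcc i j).intervalIntegrable _ _]
    refine Finset.sum_congr rfl fun i _ => ?_
    rw [intervalIntegral.integral_finsetSum fun j _ => (hcc i j).intervalIntegrable _ _]
    rw [Matrix.mulVec, dotProduct, Finset.mul_sum]
    refine Finset.sum_congr rfl fun j _ => ?_
    rw [intervalIntegral.integral_const_mul, intervalIntegral.integral_const_mul]
    simp only [P, Matrix.of_apply]
    ring
  have hnn : ∀ w : Fin m → ℝ, 0 ≤ w ⬝ᵥ w := fun w =>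
    Finset.sum_nonneg fun i _ => mul_self_nonneg _
  refine ⟨P, ?_, ?_, ?_, ?_⟩
  · ext i j
    simp only [P, Matrix.transpose_apply, Matrix.of_apply, dotProduct_comm]
  · intro x
    rw [hP]
    exact intervalIntegral.integral_nonneg zero_le_one fun t _ => hnn _
  · intro x hx
    have h1 : ∫ t in (0 : ℝ)..1, g x t ⬝ᵥ g x t = 0 := by rw [← hP, hx, dotProduct_zero]
    by_contra hne
    refine (intervalIntegral.integral_pos zero_lt_one (hdot x x).continuousOn (fun t _ => hnn _)
      ⟨0, by simp, (hnn _).lt_of_ne fun h => hne ?_⟩).ne' h1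
    rw [← hg0]
    exact dotProduct_self_eq_zero.1 h.symm
  · intro x
    have h := intervalIntegral.integral_eq_sub_of_hasDerivAt (a := 0) (b := 1)
      (f := fun t => g x t ⬝ᵥ g x t) (f' := fun t => -(2 * (g x t ⬝ᵥ g (A *ᵥ x) t)))
      (fun t _ => by
        have h := HasDerivAt.fun_sum (u := Finset.univ) fun i _ =>
          (hasDerivAt_pi.1 (hgd x t) i).mul (hasDerivAt_pi.1 (hgd x t) i)
        refine h.congr_deriv ?_
        simp only [dotProduct, Finset.mul_sum, ← Finset.sum_neg_distrib, Pi.neg_apply]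
        exact Finset.sum_congr rfl fun i _ => by ring)
      ((continuous_const.mul (hdot _ _)).neg.intervalIntegrable _ _)
    rw [intervalIntegral.integral_neg, intervalIntegral.integral_const_mul, ← hP, hg0] at h
    linarith [hnn (g x 1)]

/-- The semidefinite Gramian `P` serves as a Lyapunov function even when it is singular. Since `Ker
P ⊆ Ker C`, one has `C = Q P`, and the gain `K = -Qᵀ` satisfies `P K C = -Cᵀ C`. Hence `xᵀ P (A + K
C) x ≤ -|C x|² / 2`, which forces unstable eigenvectors into `Ker C`, where detectability of `(C,
A)` excludes them. -/
theorem exists_stabilizing_matrix {n m : ℕ} (A : Matrix (Fin n) (Fin n) ℝ)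
    (C : Matrix (Fin m) (Fin n) ℝ)
    (hdet : ∀ (μ : ℂ) (u v : Fin n → ℝ), 0 ≤ μ.re → C *ᵥ u = 0 → C *ᵥ v = 0 →
      IsEigenPair (Matrix.toLin' A) μ u v → u = 0 ∧ v = 0) :
    ∃ K : Matrix (Fin n) (Fin m) ℝ, ∀ (μ : ℂ) (u v : Fin n → ℝ), 0 ≤ μ.re →
      IsEigenPair (Matrix.toLin' (A + K * C)) μ u v → u = 0 ∧ v = 0 := by
  obtain ⟨P, hsym, hpos, hker, hlyap⟩ := exists_gramian A C
  obtain ⟨r, hr⟩ := exists_comp_eq_of_ker_le (Matrix.toLin' P) (Matrix.toLin' C)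
    (fun x hx => by simpa using hker x (by simpa using hx))
  let Q := LinearMap.toMatrix' r
  have hQ : Q * P = C := by
    apply Matrix.toLin'.injective
    rw [Matrix.toLin'_mul, Matrix.toLin'_toMatrix', hr]
  have hPQ : P * Qᵀ = Cᵀ := by rw [← hQ, Matrix.transpose_mul, hsym]
  have hswap : ∀ x y, x ⬝ᵥ P *ᵥ y = y ⬝ᵥ P *ᵥ x := fun x y => by
    rw [dotProduct_comm, ← Matrix.vecMul_transpose, hsym, ← Matrix.dotProduct_mulVec]
  have hnn : ∀ w : Fin m → ℝ, 0 ≤ w ⬝ᵥ w := fun w =>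
    Finset.sum_nonneg fun i _ => mul_self_nonneg _
  have hPK : ∀ x, x ⬝ᵥ P *ᵥ ((A + -Qᵀ * C) *ᵥ x) =
      x ⬝ᵥ P *ᵥ (A *ᵥ x) - (C *ᵥ x) ⬝ᵥ (C *ᵥ x) := fun x => by
    rw [Matrix.add_mulVec, Matrix.mulVec_add, dotProduct_add, Matrix.mulVec_mulVec _ P (-Qᵀ * C),
      ← Matrix.mul_assoc, Matrix.mul_neg, hPQ, Matrix.neg_mul, Matrix.neg_mulVec, dotProduct_neg,
      ← Matrix.mulVec_mulVec, Matrix.dotProduct_mulVec x Cᵀ, Matrix.vecMul_transpose, sub_eq_add_neg]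
  refine ⟨-Qᵀ, fun μ u v hμ huv => ?_⟩
  obtain ⟨hu, hv⟩ := huv
  rw [Matrix.toLin'_apply] at hu hv
  have e1 := hPK u
  have e2 := hPK v
  rw [hu, Matrix.mulVec_sub, Matrix.mulVec_smul, Matrix.mulVec_smul, dotProduct_sub,
    dotProduct_smul, dotProduct_smul, smul_eq_mul, smul_eq_mul] at e1
  rw [hv, Matrix.mulVec_add, Matrix.mulVec_smul, Matrix.mulVec_smul, dotProduct_add,
    dotProduct_smul, dotProduct_smul, smul_eq_mul, smul_eq_mul, hswap v u] at e2
  have h3 := mul_nonneg hμ (hpos u)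
  have h4 := mul_nonneg hμ (hpos v)
  -- In `e1 + e2` the cross terms in `μ.im` cancel by symmetry of `P`: the sum is nonnegative, yet
  -- at most `-(|C u|² + |C v|²) / 2`.
  have hCu : C *ᵥ u = 0 := dotProduct_self_eq_zero.1
    (le_antisymm (by linarith [hlyap u, hlyap v, hnn (C *ᵥ u), hnn (C *ᵥ v)]) (hnn _))
  have hCv : C *ᵥ v = 0 := dotProduct_self_eq_zero.1
    (le_antisymm (by linarith [hlyap u, hlyap v, hnn (C *ᵥ u), hnn (C *ᵥ v)]) (hnn _))
  refine hdet μ u v hμ hCu hCv ⟨?_, ?_⟩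
  · rw [Matrix.toLin'_apply, ← hu, Matrix.add_mulVec, ← Matrix.mulVec_mulVec, hCu,
      Matrix.mulVec_zero, add_zero]
  · rw [Matrix.toLin'_apply, ← hv, Matrix.add_mulVec, ← Matrix.mulVec_mulVec, hCv,
      Matrix.mulVec_zero, add_zero]

theorem IsEigenPair.map {X Y : Type*} [AddCommGroup X] [Module ℝ X] [AddCommGroup Y] [Module ℝ Y]
    {T : X →ₗ[ℝ] X} {S : Y →ₗ[ℝ] Y} (e : X →ₗ[ℝ] Y) (he : ∀ x, S (e x) = e (T x)) {μ : ℂ} {u v : X}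
    (h : IsEigenPair T μ u v) : IsEigenPair S μ (e u) (e v) := by
  refine ⟨?_, ?_⟩
  · rw [he, h.1]; simp
  · rw [he, h.2]; simp

/-- A detectable pair (in the sense of Hautus) can be stabilized by output injection. -/
theorem exists_stabilizing {X Y : Type*} [AddCommGroup X] [Module ℝ X] [FiniteDimensional ℝ X]
    [AddCommGroup Y] [Module ℝ Y] [FiniteDimensional ℝ Y] (f : X →ₗ[ℝ] X) (c : X →ₗ[ℝ] Y)
    (hdet : ∀ (μ : ℂ) (u v : X), 0 ≤ μ.re → c u = 0 → c v = 0 → IsEigenPair f μ u v →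
      u = 0 ∧ v = 0) :
    ∃ k : Y →ₗ[ℝ] X, (f + k ∘ₗ c).charpoly.rootSet ℂ ⊆ good := by
  let eX := (Module.finBasis ℝ X).equivFun
  let eY := (Module.finBasis ℝ Y).equivFun
  obtain ⟨K, hK⟩ := exists_stabilizing_matrix
    (LinearMap.toMatrix' (eX.toLinearMap ∘ₗ f ∘ₗ eX.symm.toLinearMap))
    (LinearMap.toMatrix' (eY.toLinearMap ∘ₗ c ∘ₗ eX.symm.toLinearMap))
    (fun μ u v hμ hu hv huv => by
      rw [LinearMap.toMatrix'_mulVec] at hu hv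
      rw [Matrix.toLin'_toMatrix'] at huv
      have := hdet μ (eX.symm u) (eX.symm v) hμ (by simpa using hu) (by simpa using hv)
        (huv.map eX.symm.toLinearMap (by simp))
      simpa using this)
  refine ⟨eX.symm.toLinearMap ∘ₗ Matrix.toLin' K ∘ₗ eY.toLinearMap, ?_⟩
  rw [rootSet_subset_good_iff]
  intro μ u v hμ huv
  have := hK μ (eX u) (eX v) hμ (huv.map eX.toLinearMap (fun x => by
    simp))
  simpa using this

/-! ### Admissible subspaces and the least one -/

theorem induced_mkQ {n p : ℕ} (A : Matrix (Fin n) (Fin n) ℝ) (C : Matrix (Fin p) (Fin n) ℝ)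
    (L : Matrix (Fin n) (Fin p) ℝ) (W : Submodule ℝ (Fin n → ℝ)) (h : Renders A C L W)
    (x : Fin n → ℝ) : induced A C L W h (W.mkQ x) = W.mkQ (injected A C L x) :=
  rfl

/-- Hautus-type description of the subspaces whose quotient dynamics can be stabilized by output
injection. -/
theorem exists_admissible_iff {n p : ℕ} (A : Matrix (Fin n) (Fin n) ℝ)
    (C : Matrix (Fin p) (Fin n) ℝ) (W : Submodule ℝ (Fin n → ℝ)) :
    (∃ L, Admissible A C L W) ↔ (∀ x ∈ W, C *ᵥ x = 0 → A *ᵥ x ∈ W) ∧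
      ∀ (μ : ℂ) (u v : Fin n → ℝ), 0 ≤ μ.re → C *ᵥ u = 0 → C *ᵥ v = 0 →
        A *ᵥ u - (μ.re • u - μ.im • v) ∈ W → A *ᵥ v - (μ.im • u + μ.re • v) ∈ W →
        u ∈ W ∧ v ∈ W := by
  constructor
  · rintro ⟨L, h, hs⟩
    have hL : ∀ x, C *ᵥ x = 0 → injected A C L x = A *ᵥ x := fun x hx => by
      rw [injected, Matrix.toLin'_apply, Matrix.add_mulVec, ← Matrix.mulVec_mulVec, hx,
        Matrix.mulVec_zero, add_zero]
    refine ⟨fun x hx hCx => hL x hCx ▸ h hx, fun μ u v hμ hCu hCv hu hv => ?_⟩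
    rw [rootSet_subset_good_iff] at hs
    have := hs μ (W.mkQ u) (W.mkQ v) hμ ⟨?_, ?_⟩
    · simpa using this
    · rw [induced_mkQ, hL u hCu]
      simpa using (Submodule.Quotient.eq W).2 hu
    · rw [induced_mkQ, hL v hCv]
      simpa using (Submodule.Quotient.eq W).2 hv
  · rintro ⟨hinv, hdet⟩
    obtain ⟨s, hs⟩ := W.mkQ.exists_rightInverse_of_surjective W.range_mkQ
    have hs' : ∀ y, W.mkQ (s y) = y := LinearMap.congr_fun hs
    -- Invariance only prescribes the injection on `C W`: there it must cancel `A w` modulo `W`,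
    -- which is consistent because `A` maps `W ∩ Ker C` into `W`.
    obtain ⟨r, hr⟩ := exists_comp_eq_of_ker_le (Matrix.toLin' C ∘ₗ W.subtype)
      (-(W.mkQ ∘ₗ Matrix.toLin' A ∘ₗ W.subtype)) (fun x hx => by
        simpa using hinv x x.2 (by simpa using hx))
    have hr' : ∀ x ∈ W, r (C *ᵥ x) = -W.mkQ (A *ᵥ x) := fun x hx => by
      simpa using LinearMap.congr_fun hr ⟨x, hx⟩
    have hinj : ∀ (f : (Fin p → ℝ) →ₗ[ℝ] ((Fin n → ℝ) ⧸ W)) (x : Fin n → ℝ),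
        W.mkQ (injected A C (LinearMap.toMatrix' (s ∘ₗ f)) x) =
          W.mkQ (A *ᵥ x) + f (C *ᵥ x) := fun f x => by
      rw [injected, Matrix.toLin'_apply, Matrix.add_mulVec, ← Matrix.mulVec_mulVec,
        LinearMap.toMatrix'_mulVec, map_add, LinearMap.comp_apply, hs']
    have h0 : Renders A C (LinearMap.toMatrix' (s ∘ₗ r)) W := fun x hx => by
      rw [Submodule.mem_comap, ← Submodule.Quotient.mk_eq_zero, ← Submodule.mkQ_apply, hinj,
        hr' x hx, add_neg_cancel]
    -- The remaining freedom is an injection acting through `ℝᵖ / C W`, which leaves the invariance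
    -- of `W` intact. A class modulo `W` with zero output in this quotient has a representative in
    -- `Ker C`, so the quotient pair inherits detectability from `hdet`.
    let Z := W.map (Matrix.toLin' C)
    obtain ⟨k, hk⟩ := exists_stabilizing (induced A C _ W h0)
      (W.mapQ Z (Matrix.toLin' C) (Submodule.le_comap_map _ _)) (by
        have key : ∀ x : (Fin n → ℝ) ⧸ W,
            W.mapQ Z (Matrix.toLin' C) (Submodule.le_comap_map _ _) x = 0 →
              ∃ y, W.mkQ y = x ∧ C *ᵥ y = 0 := by
          intro x hx
          obtain ⟨y, rfl⟩ := W.mkQ_surjective x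
          rw [Submodule.mkQ_apply, Submodule.mapQ_apply, Submodule.Quotient.mk_eq_zero] at hx
          obtain ⟨w, hw, hwy⟩ := hx
          refine ⟨y - w, by simpa using hw, ?_⟩
          rw [Matrix.toLin'_apply, Matrix.toLin'_apply] at hwy
          rw [Matrix.mulVec_sub, hwy, sub_self]
        have hind : ∀ y, C *ᵥ y = 0 → induced A C _ W h0 (W.mkQ y) = W.mkQ (A *ᵥ y) := by
          intro y hy
          rw [induced_mkQ, hinj, hy, map_zero, add_zero]
        intro μ u v hμ hu hv huv
        obtain ⟨u, rfl, hCu⟩ := key u hu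
        obtain ⟨v, rfl, hCv⟩ := key v hv
        obtain ⟨h1, h2⟩ := huv
        rw [hind u hCu] at h1
        rw [hind v hCv] at h2
        have := hdet μ u v hμ hCu hCv
          ((Submodule.Quotient.eq W).1 (by simpa using h1))
          ((Submodule.Quotient.eq W).1 (by simpa using h2))
        simpa using this)
    have h1 : Renders A C (LinearMap.toMatrix' (s ∘ₗ (r + k ∘ₗ Z.mkQ))) W := fun x hx => by
      have hz : Z.mkQ (C *ᵥ x) = 0 := by
        rw [Submodule.mkQ_apply, Submodule.Quotient.mk_eq_zero]
        exact ⟨x, hx, rfl⟩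
      rw [Submodule.mem_comap, ← Submodule.Quotient.mk_eq_zero, ← Submodule.mkQ_apply, hinj,
        LinearMap.add_apply, LinearMap.comp_apply, hz, hr' x hx, map_zero, add_zero,
        add_neg_cancel]
    refine ⟨_, h1, ?_⟩
    convert hk using 3
    refine Submodule.linearMap_qext _ (LinearMap.ext fun x => ?_)
    rw [LinearMap.comp_apply, LinearMap.comp_apply, LinearMap.add_apply, LinearMap.comp_apply,
      induced_mkQ, induced_mkQ, hinj, hinj]
    simp [add_assoc]

/-- In the `L`-free criterion, `W` occurs only through memberships in premises and conclusions of
implications, so the criterion survives intersection, although the members may need different `L`.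
-/
theorem isLeast_Wg {n q p : ℕ} (A : Matrix (Fin n) (Fin n) ℝ) (B₂ : Matrix (Fin n) (Fin q) ℝ)
    (C : Matrix (Fin p) (Fin n) ℝ) : IsLeast (family A B₂ C) (Wg A B₂ C) := by
  refine ⟨⟨le_sInf fun W hW => hW.1, ?_⟩, fun W hW => sInf_le hW⟩
  rw [exists_admissible_iff]
  simp only [Wg, Submodule.mem_sInf]
  refine ⟨fun x hx hCx W hW => ((exists_admissible_iff A C W).1 hW.2).1 x (hx W hW) hCx,
    fun μ u v hμ hCu hCv hu hv => ?_⟩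
  have h := fun W hW => ((exists_admissible_iff A C W).1 hW.2).2 μ u v hμ hCu hCv
    (hu W hW) (hv W hW)
  exact ⟨fun W hW => (h W hW).1, fun W hW => (h W hW).2⟩

/-! ### Decay of solutions under a Hurwitz matrix -/

open Filter Set in
-- The integrating factor `exp (-t μ)` reduces the claim to bounding a function with derivative `exp
-- (-t μ) • g t`.
theorem tendsto_zero_of_deriv_eq_smul_add {E : Type*} [NormedAddCommGroup E] [NormedSpace ℂ E]
    {μ : ℂ} (hμ : μ.re < 0) {f g : ℝ → E} (hf : ContinuousOn f (Ici 0))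
    (hd : ∀ t, 0 ≤ t → HasDerivWithinAt f (μ • f t + g t) (Ici t) t)
    (hg : Tendsto g atTop (𝓝 0)) : Tendsto f atTop (𝓝 0) := by
  obtain ⟨a, ha, hμa⟩ : ∃ a : ℝ, 0 < a ∧ μ.re = -a := ⟨-μ.re, by linarith, by ring⟩
  let h (t : ℝ) : E := Complex.exp (-(t * μ)) • f t
  have hexp : ∀ t : ℝ, HasDerivAt (fun s : ℝ => Complex.exp (-(s * μ)))
      (Complex.exp (-(t * μ)) * -μ) t := fun t => by
    have := ((Complex.ofRealCLM.hasDerivAt (x := t)).mul_const μ).neg.cexp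
    simpa using this
  have hnorm : ∀ t : ℝ, ‖Complex.exp (-(t * μ))‖ = Real.exp (a * t) := fun t => by
    rw [Complex.norm_exp]
    simp [hμa, mul_comm]
  have hh : ∀ t : ℝ, 0 ≤ t → HasDerivWithinAt h (Complex.exp (-(t * μ)) • g t) (Ici t) t := by
    intro t ht
    refine ((hexp t).hasDerivWithinAt.smul (hd t ht)).congr_deriv ?_
    module
  have hhc : ContinuousOn h (Ici 0) :=
    ContinuousOn.smul (fun t _ => (hexp t).continuousAt.continuousWithinAt) hf
  rw [Metric.tendsto_atTop]
  intro ε hε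
  -- With decay rate `a`, a forcing term below `a * (ε / 2)` contributes at most `ε / 2` to `f`.
  obtain ⟨T', hT'⟩ := Metric.tendsto_atTop.1 hg (a * (ε / 2)) (by positivity)
  let T := max T' 0
  have hT0 : 0 ≤ T := le_max_right _ _
  have hbound : ∀ t, T ≤ t → ‖f t‖ ≤ Real.exp (-(a * t)) * ‖h T‖ + ε / 2 := by
    intro t ht
    have hB : ∀ x, HasDerivAt (fun s => ‖h T‖ + ε / 2 * (Real.exp (a * s) - Real.exp (a * T)))
        (Real.exp (a * x) * (a * (ε / 2))) x := fun x => by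
      have := ((((hasDerivAt_id x).const_mul a).exp.sub_const (Real.exp (a * T))).const_mul
        (ε / 2)).const_add ‖h T‖
      refine this.congr_deriv ?_
      simp only [id, mul_one]
      ring
    have key := image_norm_le_of_norm_deriv_right_le_deriv_boundary (a := T) (b := t) (f := h)
      (f' := fun t => Complex.exp (-(t * μ)) • g t)
      (hhc.mono fun x hx => hT0.trans hx.1) (fun x hx => hh x (hT0.trans hx.1)) (by simp) hB
      (fun x hx => by
        rw [norm_smul, hnorm]
        have := hT' x ((le_max_left _ _).trans hx.1)
        rw [dist_zero_right] at this
        gcongr) (right_mem_Icc.2 ht)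
    have hft : ‖f t‖ = Real.exp (-(a * t)) * ‖h t‖ := by
      rw [norm_smul, hnorm, ← mul_assoc, ← Real.exp_add]
      simp
    have hone : Real.exp (-(a * t)) * Real.exp (a * t) = 1 := by
      rw [← Real.exp_add]; simp
    rw [hft]
    calc Real.exp (-(a * t)) * ‖h t‖
        ≤ Real.exp (-(a * t)) * (‖h T‖ + ε / 2 * (Real.exp (a * t) - Real.exp (a * T))) := by
          gcongr
      _ = Real.exp (-(a * t)) * ‖h T‖ + ε / 2 * (Real.exp (-(a * t)) * Real.exp (a * t))
          - ε / 2 * (Real.exp (-(a * t)) * Real.exp (a * T)) := by ring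
      _ ≤ _ := by
          rw [hone, mul_one]
          have : 0 ≤ ε / 2 * (Real.exp (-(a * t)) * Real.exp (a * T)) := by positivity
          linarith
  have hlim : Tendsto (fun t => Real.exp (-(a * t)) * ‖h T‖) atTop (𝓝 0) := by
    have h1 : Tendsto (fun t => Real.exp (-(a * t))) atTop (𝓝 0) :=
      Real.tendsto_exp_neg_atTop_nhds_zero.comp (tendsto_id.const_mul_atTop ha)
    simpa using h1.mul_const ‖h T‖
  obtain ⟨T₁, hT₁⟩ := (hlim.eventually_lt_const (half_pos hε)).exists_forall_of_atTop
  refine ⟨max T T₁, fun t ht => ?_⟩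
  rw [dist_zero_right]
  linarith [hbound t ((le_max_left _ _).trans ht), hT₁ t ((le_max_right _ _).trans ht)]

open Filter Set Polynomial in
-- Peeling off one linear factor: `(N - μ) f` solves the same equation and is killed by the
-- remaining product, so it tends to zero by induction; then `f' = μ f + (N - μ) f` is a scalar
-- equation with vanishing forcing. Cayley–Hamilton supplies the annihilating product, so neither
-- Jordan form nor estimates of the exponential are needed.
theorem tendsto_zero_of_aeval_eq_zero {E : Type*} [NormedAddCommGroup E] [NormedSpace ℂ E]
    [FiniteDimensional ℂ E] (N : Module.End ℂ E) (s : Multiset ℂ) (hs : ∀ μ ∈ s, μ.re < 0) :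
    ∀ f : ℝ → E, ContinuousOn f (Ici 0) →
      (∀ t, 0 ≤ t → HasDerivWithinAt f (N (f t)) (Ici t) t) →
      (∀ t, aeval N (s.map fun μ => X - C μ).prod (f t) = 0) → Tendsto f atTop (𝓝 0) := by
  induction s using Multiset.induction_on with
  | empty =>
    intro f _ _ h0
    have : f = fun _ => 0 := funext fun t => by simpa using h0 t
    rw [this]
    exact tendsto_const_nhds
  | cons μ s ih =>
    intro f hf hd h0
    let M : E →L[ℝ] E :=
      (LinearMap.toContinuousLinearMap (aeval N (X - C μ))).restrictScalars ℝ
    have hM : ∀ x, M x = N x - μ • x := fun x => by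
      change aeval N (X - C μ) x = _
      simp
    have hMN : ∀ x, M (N x) = N (M x) := fun x => by simp [hM]
    have hMf : Tendsto (fun t => M (f t)) atTop (𝓝 0) := by
      refine ih (fun ν hν => hs ν (Multiset.mem_cons_of_mem hν)) _
        (M.continuous.comp_continuousOn hf) (fun t ht => ?_) fun t => ?_
      · rw [← hMN]
        exact M.hasFDerivAt.comp_hasDerivWithinAt t (hd t ht)
      · have := h0 t
        rwa [Multiset.map_cons, Multiset.prod_cons, mul_comm, aeval_mul] at this
    refine tendsto_zero_of_deriv_eq_smul_add (hs μ (Multiset.mem_cons_self _ _)) hf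
      (fun t ht => (hd t ht).congr_deriv ?_) hMf
    rw [hM]
    abel

open Filter Set in
/-- Solutions of `ė = N e` decay when `N` is Hurwitz. -/
theorem tendsto_zero_of_rootSet_subset_good {k : ℕ} (N : Matrix (Fin k) (Fin k) ℝ)
    (hN : N.charpoly.rootSet ℂ ⊆ good) (e : ℝ → Fin k → ℝ) (he : ContinuousOn e (Ici 0))
    (hd : ∀ t, 0 ≤ t → HasDerivWithinAt e (N *ᵥ e t) (Ici t) t) : Tendsto e atTop (𝓝 0) := by
  let M := N.map (algebraMap ℝ ℂ)
  let J : (Fin k → ℝ) →L[ℝ] (Fin k → ℂ) :=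
    ContinuousLinearMap.pi fun i => Complex.ofRealCLM ∘L ContinuousLinearMap.proj i
  have hJ : ∀ x i, J x i = (x i : ℂ) := fun x i => rfl
  have hJN : ∀ x, J (N *ᵥ x) = Matrix.toLin' M (J x) := fun x => by
    ext i
    simp [hJ, M, Matrix.mulVec, dotProduct]
  have h := tendsto_zero_of_aeval_eq_zero (Matrix.toLin' M) M.charpoly.roots (fun μ hμ => by
      refine hN ?_
      rw [Polynomial.mem_rootSet_of_ne N.charpoly_monic.ne_zero, Polynomial.aeval_def,
        ← Polynomial.eval_map, ← Matrix.charpoly_map]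
      exact Polynomial.isRoot_of_mem_roots hμ)
    (fun t => J (e t)) (J.continuous.comp_continuousOn he) (fun t ht => by
      rw [← hJN]
      exact J.hasFDerivAt.comp_hasDerivWithinAt t (hd t ht)) (fun t => by
      rw [← (IsAlgClosed.splits M.charpoly).eq_prod_roots_of_monic M.charpoly_monic,
        ← Matrix.charpoly_toLin', LinearMap.aeval_self_charpoly, LinearMap.zero_apply])
  rw [tendsto_pi_nhds] at h ⊢
  intro i
  have := (Complex.continuous_re.tendsto _).comp (h i)
  simpa [Function.comp_def, hJ] using this

open Filter Set MeasureTheory in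
-- A Carathéodory solution is continuous as a primitive; the right-hand side is then continuous too,
-- so the solution has the right derivatives required by the classical version.
theorem tendsto_zero_of_solves {k : ℕ} (N : Matrix (Fin k) (Fin k) ℝ)
    (hN : N.charpoly.rootSet ℂ ⊆ good) (e : ℝ → Fin k → ℝ) (he : Solves e fun t => N *ᵥ e t) :
    Tendsto e atTop (𝓝 0) := by
  have hcont : ContinuousOn e (Ici 0) := by
    intro t ht
    have ht : 0 ≤ t := ht
    have h1 : ContinuousOn e (Icc 0 (t + 1)) := by
      have h2 := intervalIntegral.continuousOn_primitive_interval' (he (t + 1) (by linarith)).1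
        left_mem_uIcc
      rw [uIcc_of_le (by linarith)] at h2
      exact (continuousOn_const.add h2).congr fun s hs => (he s hs.1).2
    refine (h1 t ⟨ht, by linarith⟩).mono_of_mem_nhdsWithin ?_
    filter_upwards [self_mem_nhdsWithin, mem_nhdsWithin_of_mem_nhds (Iio_mem_nhds (lt_add_one t))]
      with s hs hs' using ⟨hs, hs'.le⟩
  have hNc : ContinuousOn (fun t => N *ᵥ e t) (Ici 0) :=
    (Matrix.toLin' N).toContinuousLinearMap.continuous.comp_continuousOn hcont
  refine tendsto_zero_of_rootSet_subset_good N hN e hcont fun t ht => ?_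
  have hsub : Ioi t ⊆ Ici 0 := fun s hs => ht.trans (le_of_lt hs)
  have h := intervalIntegral.integral_hasDerivWithinAt_right (s := Ici t) (t := Ioi t)
    (he t ht).1 ((hNc.stronglyMeasurableAtFilter_nhdsWithin measurableSet_Ici t).filter_mono
      (nhdsWithin_mono t hsub)) ((hNc t ht).mono hsub)
  exact (h.const_add (e 0)).congr (fun s hs => (he s (ht.trans hs)).2) (he t ht).2

/-! ### Sufficiency: the error dynamics -/

theorem Solves.mulVec {n k : ℕ} {x f : ℝ → Fin n → ℝ} (h : Solves x f)
    (P : Matrix (Fin k) (Fin n) ℝ) : Solves (fun t => P *ᵥ x t) fun t => P *ᵥ f t := by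
  intro t ht
  obtain ⟨h1, h2⟩ := h t ht
  let J := (Matrix.toLin' P).toContinuousLinearMap
  refine ⟨⟨J.integrable_comp h1.1, J.integrable_comp h1.2⟩, ?_⟩
  have h3 := J.intervalIntegral_comp_comm h1
  change ∫ s in (0 : ℝ)..t, P *ᵥ f s = P *ᵥ ∫ s in (0 : ℝ)..t, f s at h3
  simp only [h3]
  rw [h2, Matrix.mulVec_add]

theorem Solves.sub {n : ℕ} {x y f g : ℝ → Fin n → ℝ} (hx : Solves x f) (hy : Solves y g) :
    Solves (fun t => x t - y t) fun t => f t - g t := by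
  intro t ht
  obtain ⟨h1, h2⟩ := hx t ht
  obtain ⟨h3, h4⟩ := hy t ht
  refine ⟨h1.sub h3, ?_⟩
  simp only []
  rw [intervalIntegral.integral_sub h1 h3, h2, h4]
  abel

theorem isUnknownInputObserver_of_eq_one {n l q p k : ℕ} {A : Matrix (Fin n) (Fin n) ℝ}
    (B₁ : Matrix (Fin n) (Fin l) ℝ) {B₂ : Matrix (Fin n) (Fin q) ℝ} {C : Matrix (Fin p) (Fin n) ℝ}
    {L : Matrix (Fin n) (Fin p) ℝ} {N : Matrix (Fin k) (Fin k) ℝ} {P : Matrix (Fin k) (Fin n) ℝ}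
    {E : Matrix (Fin n) (Fin k) ℝ} {F : Matrix (Fin n) (Fin p) ℝ}
    (hN : N.charpoly.rootSet ℂ ⊆ good) (hNP : N * P = P * (A + L * C)) (hPB : P * B₂ = 0)
    (hEF : E * P + F * C = 1) :
    IsUnknownInputObserver A B₁ B₂ C N (P * B₁) (-(P * L)) E F := by
  intro u₁ u₂ x z _ _ hx hz
  have he : Solves (fun t => z t - P *ᵥ x t) fun t => N *ᵥ (z t - P *ᵥ x t) := by
    convert hz.sub (hx.mulVec P) using 2 with t
    have h1 : N *ᵥ (P *ᵥ x t) = P *ᵥ (A *ᵥ x t) + (P * L) *ᵥ (C *ᵥ x t) := by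
      rw [Matrix.mulVec_mulVec, hNP, Matrix.mul_add, Matrix.add_mulVec, Matrix.mulVec_mulVec,
        Matrix.mulVec_mulVec, Matrix.mul_assoc]
    rw [Matrix.mulVec_sub, h1, Matrix.mulVec_add, Matrix.mulVec_add, Matrix.mulVec_mulVec _ P B₂,
      hPB, Matrix.zero_mulVec, Matrix.mulVec_mulVec _ P B₁, Matrix.neg_mulVec]
    abel
  have hlim := tendsto_zero_of_solves N hN _ he
  have h2 : ∀ t, x t - (E *ᵥ z t + F *ᵥ (C *ᵥ x t)) = -(E *ᵥ (z t - P *ᵥ x t)) := fun t => by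
    have h3 : x t = E *ᵥ (P *ᵥ x t) + F *ᵥ (C *ᵥ x t) := by
      rw [Matrix.mulVec_mulVec, Matrix.mulVec_mulVec, ← Matrix.add_mulVec, hEF, Matrix.one_mulVec]
    rw [Matrix.mulVec_sub]
    linear_combination h3
  simp only [h2, norm_neg]
  have h4 := ((Matrix.toLin' E).toContinuousLinearMap.continuous.tendsto _).comp hlim
  simpa using h4.norm

/-! ### Necessity: unobservable subspaces and test trajectories -/

/-- A curve that starts in an `A`-invariant subspace `S` and solves `ẏ = A y` modulo `S` stays in
`S`. -/
theorem mem_of_deriv_sub_mem {n : ℕ} (A : Matrix (Fin n) (Fin n) ℝ)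
    (S : Submodule ℝ (Fin n → ℝ)) (hS : ∀ x ∈ S, A *ᵥ x ∈ S) {y y' : ℝ → Fin n → ℝ}
    (hd : ∀ t, HasDerivAt y (y' t) t) (hy : ∀ t, y' t - A *ᵥ y t ∈ S) (h0 : y 0 ∈ S) (t : ℝ) :
    y t ∈ S := by
  -- In coordinates of the quotient by `S`, the curve solves a linear equation with zero initial
  -- value, so uniqueness makes it vanish.
  let J := (Module.finBasis ℝ ((Fin n → ℝ) ⧸ S)).equivFun.toLinearMap ∘ₗ S.mkQ
  have hJ : ∀ x, J x = 0 ↔ x ∈ S := fun x => by simp [J]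
  obtain ⟨r, hr⟩ := exists_comp_eq_of_ker_le J (J ∘ₗ Matrix.toLin' A) (fun x hx => by
    simpa [hJ] using hS x ((hJ x).1 hx))
  have hr' : ∀ x, r (J x) = J (A *ᵥ x) := fun x => by simpa using LinearMap.congr_fun hr x
  let rc := r.toContinuousLinearMap
  have hJd : ∀ t, HasDerivAt (fun s => J (y s)) (rc (J (y t))) t := fun t => by
    have h := J.toContinuousLinearMap.hasFDerivAt.comp_hasDerivAt t (hd t)
    refine h.congr_deriv ?_
    have h1 := (hJ _).2 (hy t)
    rw [map_sub, sub_eq_zero] at h1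
    exact h1.trans (hr' _).symm
  have h := ODE_solution_unique_univ (v := fun _ => rc) (s := fun _ => Set.univ) (t₀ := 0)
    (fun _ => rc.lipschitz.lipschitzOnWith) (fun t => ⟨hJd t, trivial⟩)
    (g := fun _ => 0) (fun t => ⟨by simpa using hasDerivAt_const t _, trivial⟩)
    (by simpa using (hJ _).2 h0)
  exact (hJ _).1 (congrFun h t)

open Filter in
-- The squares of the two expressions add up to `exp (2 a t) (α² + β²)`, which is at least `α² + β²`
-- for `t ≥ 0`.
theorem eq_zero_of_tendsto_rotation {a b α β : ℝ} (ha : 0 ≤ a)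
    (h1 : Tendsto (fun t => Real.exp (a * t) * (Real.cos (b * t) * α - Real.sin (b * t) * β))
      atTop (𝓝 0))
    (h2 : Tendsto (fun t => Real.exp (a * t) * (Real.sin (b * t) * α + Real.cos (b * t) * β))
      atTop (𝓝 0)) : α = 0 ∧ β = 0 := by
  have h := (h1.mul h1).add (h2.mul h2)
  have hle : α * α + β * β ≤ 0 := by
    rw [mul_zero, add_zero] at h
    refine ge_of_tendsto h ?_
    filter_upwards [eventually_ge_atTop 0] with t ht
    have e : Real.exp (a * t) * (Real.cos (b * t) * α - Real.sin (b * t) * β) *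
        (Real.exp (a * t) * (Real.cos (b * t) * α - Real.sin (b * t) * β)) +
        Real.exp (a * t) * (Real.sin (b * t) * α + Real.cos (b * t) * β) *
        (Real.exp (a * t) * (Real.sin (b * t) * α + Real.cos (b * t) * β)) =
        Real.exp (a * t) * Real.exp (a * t) * (α * α + β * β) := by
      linear_combination Real.exp (a * t) * Real.exp (a * t) * (α * α + β * β) *
        Real.sin_sq_add_cos_sq (b * t)
    rw [e]
    have h3 : 1 ≤ Real.exp (a * t) := Real.one_le_exp (mul_nonneg ha ht)
    nlinarith [mul_self_nonneg α, mul_self_nonneg β, one_le_mul_of_one_le_of_one_le h3 h3]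
  constructor <;> nlinarith [mul_self_nonneg α, mul_self_nonneg β]

open Filter in
/-- If `R x → 0` along all solutions of `ẋ = A x`, then `A` has no eigenvalue in the closed right
half-plane modulo the unobservable subspace `S` of `(R, A)`. -/
theorem mem_of_eigenPair_mod {n m : ℕ} (A : Matrix (Fin n) (Fin n) ℝ)
    (R : Matrix (Fin m) (Fin n) ℝ) (S : Submodule ℝ (Fin n → ℝ))
    (hS : ∀ x, x ∈ S ↔ ∀ k : ℕ, (R * A ^ k) *ᵥ x = 0)
    (hR : ∀ x : ℝ → Fin n → ℝ, (∀ t, HasDerivAt x (A *ᵥ x t) t) →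
      Tendsto (fun t => R *ᵥ x t) atTop (𝓝 0))
    (μ : ℂ) (u v : Fin n → ℝ) (hμ : 0 ≤ μ.re) (hu : A *ᵥ u - (μ.re • u - μ.im • v) ∈ S)
    (hv : A *ᵥ v - (μ.im • u + μ.re • v) ∈ S) : u ∈ S ∧ v ∈ S := by
  have hinv : ∀ x ∈ S, A *ᵥ x ∈ S := fun x hx => (hS _).2 fun k => by
    rw [Matrix.mulVec_mulVec, Matrix.mul_assoc, ← pow_succ]
    exact (hS x).1 hx (k + 1)
  obtain ⟨Φ, h0, hd, hc⟩ := exists_flow A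
  generalize μ.re = a at *
  generalize μ.im = b at *
  have hex : ∀ t, HasDerivAt (fun s => Real.exp (a * s)) (Real.exp (a * t) * a) t := fun t => by
    simpa using ((hasDerivAt_id t).const_mul a).exp
  have hcos : ∀ t, HasDerivAt (fun s => Real.cos (b * s)) (-Real.sin (b * t) * b) t := fun t => by
    simpa using ((hasDerivAt_id t).const_mul b).cos
  have hsin : ∀ t, HasDerivAt (fun s => Real.sin (b * s)) (Real.cos (b * t) * b) t := fun t => by
    simpa using ((hasDerivAt_id t).const_mul b).sin
  have key : ∀ (y y' : ℝ → Fin n → ℝ), (∀ t, HasDerivAt y (y' t) t) →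
      (∀ t, y' t - A *ᵥ y t ∈ S) → ∀ k : ℕ,
      Tendsto (fun t => (R * A ^ k) *ᵥ y t) atTop (𝓝 0) := by
    intro y y' hy hyS k
    -- Modulo `S`, the curve is a genuine solution of `ẋ = A x`. As `R A ^ k` kills `S` and `A ^ k`
    -- commutes with the flow, `R A ^ k y` is `R` along the solution starting at `A ^ k y(0)`.
    have hmem : ∀ t, y t - Φ t *ᵥ y 0 ∈ S := by
      refine mem_of_deriv_sub_mem A S hinv (fun t => (hy t).sub (hd t (y 0))) (fun t => ?_)
        (by simp [h0])
      convert hyS t using 1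
      rw [Matrix.mulVec_sub]
      abel
    have h := hR (fun t => Φ t *ᵥ (A ^ k *ᵥ y 0)) fun t => hd t _
    refine h.congr fun t => ?_
    have h1 := (hS _).1 (hmem t) k
    rw [Matrix.mulVec_sub, sub_eq_zero] at h1
    rw [h1]
    simp only [Matrix.mulVec_mulVec, Matrix.mul_assoc,
      ((show Commute A (Φ t) from hc t).pow_left k).eq]
  -- The two test curves are the real and imaginary parts of `exp (μ t) (u + i v)`.
  have k1 := key (fun t => Real.exp (a * t) • (Real.cos (b * t) • u - Real.sin (b * t) • v)) _
    (fun t => (hex t).smul (((hcos t).smul_const u).sub ((hsin t).smul_const v))) (fun t => by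
      have := S.sub_mem (S.smul_mem (-Real.exp (a * t) * Real.cos (b * t)) hu)
        (S.smul_mem (-Real.exp (a * t) * Real.sin (b * t)) hv)
      convert this using 1
      simp only [Matrix.mulVec_smul, Matrix.mulVec_sub]
      module)
  have k2 := key (fun t => Real.exp (a * t) • (Real.sin (b * t) • u + Real.cos (b * t) • v)) _
    (fun t => (hex t).smul (((hsin t).smul_const u).add ((hcos t).smul_const v))) (fun t => by
      have := S.add_mem (S.smul_mem (-Real.exp (a * t) * Real.sin (b * t)) hu)
        (S.smul_mem (-Real.exp (a * t) * Real.cos (b * t)) hv)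
      convert this using 1
      simp only [Matrix.mulVec_smul, Matrix.mulVec_add]
      module)
  have hz : ∀ k i, ((R * A ^ k) *ᵥ u) i = 0 ∧ ((R * A ^ k) *ᵥ v) i = 0 := by
    intro k i
    refine eq_zero_of_tendsto_rotation (b := b) hμ ?_ ?_
    · have := tendsto_pi_nhds.1 (k1 k) i
      simpa only [Matrix.mulVec_smul, Matrix.mulVec_sub, Pi.smul_apply, Pi.sub_apply, smul_eq_mul,
        Pi.zero_apply] using this
    · have := tendsto_pi_nhds.1 (k2 k) i
      simpa only [Matrix.mulVec_smul, Matrix.mulVec_add, Pi.smul_apply, Pi.add_apply, smul_eq_mul,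
        Pi.zero_apply] using this
  exact ⟨(hS u).2 fun k => funext fun i => (hz k i).1, (hS v).2 fun k => funext fun i => (hz k i).2⟩

open Filter in
/-- An `A`-invariant subspace containing `Im B` is generated by the steady-state responses to
exponentially growing inputs. -/
theorem exists_invariant_of_exponential {n q m : ℕ} (A : Matrix (Fin n) (Fin n) ℝ)
    (B : Matrix (Fin n) (Fin q) ℝ) (R : Matrix (Fin m) (Fin n) ℝ)
    (hR : ∀ (μ : ℝ) (x : Fin n → ℝ) (ξ : Fin q → ℝ), 0 ≤ μ → μ • x = A *ᵥ x + B *ᵥ ξ →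
      R *ᵥ x = 0) :
    ∃ V : Submodule ℝ (Fin n → ℝ), (∀ x ∈ V, A *ᵥ x ∈ V) ∧
      LinearMap.range (Matrix.toLin' B) ≤ V ∧ ∀ x ∈ V, R *ᵥ x = 0 := by
  let V : Submodule ℝ (Fin n → ℝ) :=
    Submodule.span ℝ {x | ∃ (μ : ℝ) (ξ : Fin q → ℝ), 0 ≤ μ ∧ μ • x = A *ᵥ x + B *ᵥ ξ}
  let T := (Matrix.toLin' A).toContinuousLinearMap
  have hT : ∀ x, A *ᵥ x = T x := fun x => rfl
  have hB : ∀ ξ, B *ᵥ ξ ∈ V := by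
    intro ξ
    -- Shifts `μ` above the operator norm make `μ - A` invertible. As `μ → ∞` the solutions `x` tend
    -- to zero, so `μ x = A x + B ξ` tends to `B ξ`, which lies in `V` because `V` is closed.
    have hex : ∀ j : ℕ, ∃ x : Fin n → ℝ, (‖T‖ + 1 + j) • x = A *ᵥ x + B *ᵥ ξ := by
      intro j
      have hinj : Function.Injective
          ((‖T‖ + 1 + j) • (LinearMap.id : (Fin n → ℝ) →ₗ[ℝ] _) - Matrix.toLin' A) := by
        rw [← LinearMap.ker_eq_bot, LinearMap.ker_eq_bot']
        intro x hx
        have hx' : (‖T‖ + 1 + j) • x = T x := by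
          rw [← hT]
          simpa [sub_eq_zero] using hx
        have h1 := congrArg norm hx'
        rw [norm_smul, Real.norm_of_nonneg (by positivity)] at h1
        have h2 := T.le_opNorm x
        have h3 : (1 + (j : ℝ)) * ‖x‖ ≤ 0 := by linarith
        have h4 : ‖x‖ ≤ 0 := by
          have : 0 ≤ (j : ℝ) * ‖x‖ := by positivity
          linarith
        exact norm_le_zero_iff.1 h4
      obtain ⟨x, hx⟩ := LinearMap.injective_iff_surjective.1 hinj (B *ᵥ ξ)
      refine ⟨x, ?_⟩
      rw [← hx]
      simp
    choose x hx using hex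
    have hnorm : ∀ j : ℕ, ‖x j‖ ≤ ‖B *ᵥ ξ‖ * (1 / ((j : ℝ) + 1)) := by
      intro j
      have h1 := congrArg norm (hx j)
      rw [norm_smul, Real.norm_of_nonneg (by positivity)] at h1
      have h2 := (norm_add_le (A *ᵥ x j) (B *ᵥ ξ))
      have h3 := T.le_opNorm (x j)
      rw [← hT] at h3
      rw [mul_one_div, le_div_iff₀ (by positivity)]
      linarith
    have hx0 : Tendsto x atTop (𝓝 0) := by
      refine squeeze_zero_norm hnorm ?_
      simpa using tendsto_one_div_add_atTop_nhds_zero_nat.const_mul ‖B *ᵥ ξ‖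
    have hlim : Tendsto (fun j : ℕ => (‖T‖ + 1 + j) • x j) atTop (𝓝 (B *ᵥ ξ)) := by
      have h := ((T.continuous.tendsto 0).comp hx0).add_const (B *ᵥ ξ)
      rw [map_zero, zero_add] at h
      exact h.congr fun j => (hx j).symm
    exact V.closed_of_finiteDimensional.mem_of_tendsto hlim (Eventually.of_forall fun j =>
      V.smul_mem _ (Submodule.subset_span ⟨_, ξ, by positivity, hx j⟩))
  refine ⟨V, fun x hx => ?_, ?_, fun x hx => ?_⟩
  · induction hx using Submodule.span_induction with
    | mem x h =>
      obtain ⟨μ, ξ, hμ, h⟩ := h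
      rw [← sub_eq_iff_eq_add] at h
      rw [← h]
      exact V.sub_mem (V.smul_mem _ (Submodule.subset_span ⟨μ, ξ, hμ, sub_eq_iff_eq_add.1 h⟩)) (hB ξ)
    | zero => simp
    | add x y _ _ hx hy => rw [Matrix.mulVec_add]; exact V.add_mem hx hy
    | smul c x _ hx => rw [Matrix.mulVec_smul]; exact V.smul_mem c hx
  · rintro _ ⟨ξ, rfl⟩
    exact hB ξ
  · induction hx using Submodule.span_induction with
    | mem x h =>
      obtain ⟨μ, ξ, hμ, h⟩ := h
      exact hR μ x ξ hμ h
    | zero => simp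
    | add x y _ _ hx hy => rw [Matrix.mulVec_add, hx, hy, add_zero]
    | smul c x _ hx => rw [Matrix.mulVec_smul, hx, smul_zero]

open Filter in
/-- If `R x → 0` along all trajectories of `ẋ = A x + B₂ u`, then `R` vanishes on `W_g*`. -/
theorem mulVec_eq_zero_of_mem_Wg {n q p m : ℕ} (A : Matrix (Fin n) (Fin n) ℝ)
    (B₂ : Matrix (Fin n) (Fin q) ℝ) (C : Matrix (Fin p) (Fin n) ℝ) (R : Matrix (Fin m) (Fin n) ℝ)
    (hR : ∀ (u : ℝ → Fin q → ℝ) (x : ℝ → Fin n → ℝ), Continuous u →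
      (∀ t, HasDerivAt x (A *ᵥ x t + B₂ *ᵥ u t) t) → Tendsto (fun t => R *ᵥ x t) atTop (𝓝 0))
    (w : Fin n → ℝ) (hw : w ∈ Wg A B₂ C) : R *ᵥ w = 0 := by
  -- The unobservable subspace of `(R, A)`. Once it is in the family, it contains `W_g*`, and the
  -- term `k = 0` gives the claim.
  let S : Submodule ℝ (Fin n → ℝ) := ⨅ k : ℕ, LinearMap.ker (Matrix.toLin' (R * A ^ k))
  have hS : ∀ x, x ∈ S ↔ ∀ k : ℕ, (R * A ^ k) *ᵥ x = 0 := fun x => by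
    simp only [S, Submodule.mem_iInf, LinearMap.mem_ker, Matrix.toLin'_apply]
  have hmem : S ∈ family A B₂ C := by
    refine ⟨?_, (exists_admissible_iff A C S).2 ⟨fun x hx _ => (hS _).2 fun k => ?_, ?_⟩⟩
    · obtain ⟨V, hAV, hBV, hRV⟩ := exists_invariant_of_exponential A B₂ R (fun μ x ξ hμ hx => by
        have hd : ∀ t, HasDerivAt (fun s => Real.exp (μ * s)) (Real.exp (μ * t) * μ) t :=
          fun t => by simpa using ((hasDerivAt_id t).const_mul μ).exp
        have h := hR (fun t => Real.exp (μ * t) • ξ) (fun t => Real.exp (μ * t) • x)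
          (by fun_prop) (fun t => ((hd t).smul_const x).congr_deriv (by
            rw [mul_smul, hx, smul_add, Matrix.mulVec_smul, Matrix.mulVec_smul]))
        -- The input `exp (μ t) ξ` has the trajectory `exp (μ t) x`; since `μ ≥ 0`, its output norm
        -- never drops below `‖R x‖`.
        have hle : ‖R *ᵥ x‖ ≤ 0 := by
          refine ge_of_tendsto (by simpa using h.norm) ?_
          filter_upwards [eventually_ge_atTop 0] with t ht
          rw [Matrix.mulVec_smul, norm_smul, Real.norm_of_nonneg (Real.exp_pos _).le]
          exact le_mul_of_one_le_left (norm_nonneg _) (Real.one_le_exp (mul_nonneg hμ ht))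
        exact norm_le_zero_iff.1 hle)
      refine hBV.trans fun x hx => (hS x).2 fun k => ?_
      have hk : A ^ k *ᵥ x ∈ V := by
        induction k with
        | zero => simpa using hx
        | succ k ih => rw [pow_succ', ← Matrix.mulVec_mulVec]; exact hAV _ ih
      rw [← Matrix.mulVec_mulVec]
      exact hRV _ hk
    · rw [Matrix.mulVec_mulVec, Matrix.mul_assoc, ← pow_succ]
      exact (hS x).1 hx (k + 1)
    · intro μ u v hμ _ _ hu hv
      exact mem_of_eigenPair_mod A R S hS
        (fun x hx => hR (fun _ => 0) x continuous_const (by simpa using hx)) μ u v hμ hu hv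
  have h : w ∈ S := (isLeast_Wg A B₂ C).2 hmem hw
  simpa using (hS w).1 h 0

/-! ### Matrices of the quotient maps and conclusion -/

theorem solves_of_hasDerivAt {n : ℕ} {x f : ℝ → Fin n → ℝ} (hd : ∀ t, HasDerivAt x (f t) t)
    (hf : Continuous f) : Solves x f := fun t _ => by
  have hi := hf.intervalIntegrable (μ := MeasureTheory.volume) 0 t
  refine ⟨hi, ?_⟩
  rw [intervalIntegral.integral_eq_sub_of_hasDerivAt (fun s _ => hd s) hi]
  abel

theorem projMatrix_mulVec {n k : ℕ} (W : Submodule ℝ (Fin n → ℝ))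
    (b : Module.Basis (Fin k) ℝ ((Fin n → ℝ) ⧸ W)) (x : Fin n → ℝ) :
    projMatrix W b *ᵥ x = b.equivFun (W.mkQ x) := by
  have h := LinearMap.toMatrix_mulVec_repr (Pi.basisFun ℝ (Fin n)) b W.mkQ x
  exact h

theorem inducedMatrix_mul_projMatrix {n p k : ℕ} (A : Matrix (Fin n) (Fin n) ℝ)
    (C : Matrix (Fin p) (Fin n) ℝ) (L : Matrix (Fin n) (Fin p) ℝ) (W : Submodule ℝ (Fin n → ℝ))
    (b : Module.Basis (Fin k) ℝ ((Fin n → ℝ) ⧸ W)) (h : Renders A C L W) :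
    inducedMatrix A C L W b h * projMatrix W b = projMatrix W b * (A + L * C) := by
  refine Matrix.toLin'.injective (LinearMap.ext fun x => ?_)
  rw [Matrix.toLin'_apply, Matrix.toLin'_apply, ← Matrix.mulVec_mulVec, ← Matrix.mulVec_mulVec,
    projMatrix_mulVec, projMatrix_mulVec]
  have h1 := LinearMap.toMatrix_mulVec_repr b b (induced A C L W h) (W.mkQ x)
  rw [induced_mkQ] at h1
  exact h1

theorem projMatrix_mul_eq_zero {n q k : ℕ} (W : Submodule ℝ (Fin n → ℝ))
    (b : Module.Basis (Fin k) ℝ ((Fin n → ℝ) ⧸ W)) (B : Matrix (Fin n) (Fin q) ℝ)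
    (hB : LinearMap.range (Matrix.toLin' B) ≤ W) : projMatrix W b * B = 0 := by
  refine Matrix.toLin'.injective (LinearMap.ext fun x => ?_)
  have hx : W.mkQ (B *ᵥ x) = 0 := (Submodule.Quotient.mk_eq_zero W).2 (hB ⟨x, rfl⟩)
  rw [Matrix.toLin'_apply, ← Matrix.mulVec_mulVec, projMatrix_mulVec, hx]
  simp

/-- The map `x ↦ (P x, C x)` has kernel `W ∩ Ker C = 0`; `E` and `F` are the two blocks of a left
inverse. -/
theorem exists_mul_projMatrix_add_mul_eq_one {n p k : ℕ} (C : Matrix (Fin p) (Fin n) ℝ)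
    (W : Submodule ℝ (Fin n → ℝ)) (b : Module.Basis (Fin k) ℝ ((Fin n → ℝ) ⧸ W))
    (hWC : W ⊓ LinearMap.ker (Matrix.toLin' C) = ⊥) :
    ∃ (E : Matrix (Fin n) (Fin k) ℝ) (F : Matrix (Fin n) (Fin p) ℝ),
      E * projMatrix W b + F * C = 1 := by
  obtain ⟨g, hg⟩ := LinearMap.exists_leftInverse_of_injective
    ((b.equivFun.toLinearMap ∘ₗ W.mkQ).prod (Matrix.toLin' C)) (by
      rw [LinearMap.ker_prod, LinearEquiv.ker_comp, Submodule.ker_mkQ, hWC])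
  refine ⟨LinearMap.toMatrix' (g ∘ₗ LinearMap.inl ℝ _ _),
    LinearMap.toMatrix' (g ∘ₗ LinearMap.inr ℝ _ _), ?_⟩
  refine Matrix.toLin'.injective (LinearMap.ext fun x => ?_)
  have h := LinearMap.congr_fun hg x
  rw [Matrix.toLin'_apply, Matrix.add_mulVec, ← Matrix.mulVec_mulVec, ← Matrix.mulVec_mulVec,
    LinearMap.toMatrix'_mulVec, LinearMap.toMatrix'_mulVec, projMatrix_mulVec,
    LinearMap.comp_apply, LinearMap.comp_apply, ← map_add, Matrix.toLin'_one]
  simpa using h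

/-- The observer can work only if `W_g*` meets the kernel of `C` trivially. -/
theorem Wg_inf_ker_eq_bot {n l q p k : ℕ} (A : Matrix (Fin n) (Fin n) ℝ)
    (B₁ : Matrix (Fin n) (Fin l) ℝ) (B₂ : Matrix (Fin n) (Fin q) ℝ) (C : Matrix (Fin p) (Fin n) ℝ)
    (L : Matrix (Fin n) (Fin p) ℝ) (N : Matrix (Fin k) (Fin k) ℝ) (P : Matrix (Fin k) (Fin n) ℝ)
    (E : Matrix (Fin n) (Fin k) ℝ) (F : Matrix (Fin n) (Fin p) ℝ)
    (hNP : N * P = P * (A + L * C)) (hPB : P * B₂ = 0) (hPW : ∀ w ∈ Wg A B₂ C, P *ᵥ w = 0)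
    (hobs : IsUnknownInputObserver A B₁ B₂ C N (P * B₁) (-(P * L)) E F) :
    Wg A B₂ C ⊓ LinearMap.ker (Matrix.toLin' C) = ⊥ := by
  rw [eq_bot_iff]
  rintro w ⟨hw, hCw⟩
  have hCw : C *ᵥ w = 0 := hCw
  have hR := mulVec_eq_zero_of_mem_Wg A B₂ C (1 - E * P - F * C) (fun u x hu hx => by
    have hxc : Continuous x := continuous_iff_continuousAt.2 fun t => (hx t).continuousAt
    have hsx : Solves x fun t => A *ᵥ x t + B₁ *ᵥ (0 : ℝ → Fin l → ℝ) t + B₂ *ᵥ u t := by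
      simp only [Pi.zero_apply, Matrix.mulVec_zero, add_zero]
      exact solves_of_hasDerivAt hx (by fun_prop)
    -- `P x` is itself an observer trajectory, for any `u`, because `N P = P (A + L C)` and `P B₂ =
    -- 0`.
    have hsz : Solves (fun t => P *ᵥ x t) fun t =>
        N *ᵥ (P *ᵥ x t) + (P * B₁) *ᵥ (0 : ℝ → Fin l → ℝ) t + -(P * L) *ᵥ (C *ᵥ x t) := by
      convert hsx.mulVec P using 2 with t
      simp only [Pi.zero_apply, Matrix.mulVec_zero, add_zero, Matrix.mulVec_add,
        Matrix.mulVec_mulVec, hNP, hPB, Matrix.zero_mulVec, ← Matrix.add_mulVec]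
      congr 1
      rw [Matrix.mul_add, Matrix.neg_mul, Matrix.mul_assoc]
      abel
    have h := hobs 0 u x _ (continuous_zero.locallyIntegrable.locallyIntegrableOn _)
      (hu.locallyIntegrable.locallyIntegrableOn _) hsx hsz
    rw [← tendsto_zero_iff_norm_tendsto_zero] at h
    refine h.congr fun t => ?_
    simp only [Matrix.sub_mulVec, Matrix.one_mulVec, Matrix.mulVec_mulVec, sub_sub,
      Matrix.add_mulVec]) w hw
  rw [Submodule.mem_bot]
  simpa only [Matrix.sub_mulVec, Matrix.one_mulVec, ← Matrix.mulVec_mulVec, hPW w hw, hCw,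
    Matrix.mulVec_zero, sub_zero] using hR

end Observer

theorem lemma2 {n l q p : ℕ} (A : Matrix (Fin n) (Fin n) ℝ)
    (B₁ : Matrix (Fin n) (Fin l) ℝ) (B₂ : Matrix (Fin n) (Fin q) ℝ)
    (C : Matrix (Fin p) (Fin n) ℝ) :
    IsLeast (Observer.family A B₂ C) (Observer.Wg A B₂ C) ∧
    ∀ (b : Module.Basis (Fin (n - Module.finrank ℝ (Observer.Wg A B₂ C))) ℝ
          ((Fin n → ℝ) ⧸ Observer.Wg A B₂ C))
      (L : Matrix (Fin n) (Fin p) ℝ) (hL : Observer.Renders A C L (Observer.Wg A B₂ C)),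
      (Observer.induced A C L (Observer.Wg A B₂ C) hL).charpoly.rootSet ℂ ⊆ Observer.good →
      ((∃ (E : Matrix (Fin n) (Fin (n - Module.finrank ℝ (Observer.Wg A B₂ C))) ℝ)
          (F : Matrix (Fin n) (Fin p) ℝ),
          Observer.IsUnknownInputObserver A B₁ B₂ C
            (Observer.inducedMatrix A C L (Observer.Wg A B₂ C) b hL)
            (Observer.projMatrix (Observer.Wg A B₂ C) b * B₁)
            (-(Observer.projMatrix (Observer.Wg A B₂ C) b * L)) E F) ↔
        Observer.Wg A B₂ C ⊓ LinearMap.ker (Matrix.toLin' C) = ⊥) ∧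
      (Observer.Wg A B₂ C ⊓ LinearMap.ker (Matrix.toLin' C) = ⊥ →
        ∃ (E : Matrix (Fin n) (Fin (n - Module.finrank ℝ (Observer.Wg A B₂ C))) ℝ)
          (F : Matrix (Fin n) (Fin p) ℝ),
          E * Observer.projMatrix (Observer.Wg A B₂ C) b + F * C = 1) ∧
      (∀ (E : Matrix (Fin n) (Fin (n - Module.finrank ℝ (Observer.Wg A B₂ C))) ℝ)
          (F : Matrix (Fin n) (Fin p) ℝ),
          E * Observer.projMatrix (Observer.Wg A B₂ C) b + F * C = 1 →
          Observer.IsUnknownInputObserver A B₁ B₂ C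
            (Observer.inducedMatrix A C L (Observer.Wg A B₂ C) b hL)
            (Observer.projMatrix (Observer.Wg A B₂ C) b * B₁)
            (-(Observer.projMatrix (Observer.Wg A B₂ C) b * L)) E F) := by
  refine ⟨Observer.isLeast_Wg A B₂ C, fun b L hL hspec => ?_⟩
  have hmem := (Observer.isLeast_Wg A B₂ C).1
  have hNP := Observer.inducedMatrix_mul_projMatrix A C L _ b hL
  have hPB := Observer.projMatrix_mul_eq_zero _ b B₂ hmem.1
  have hN : (Observer.inducedMatrix A C L _ b hL).charpoly.rootSet ℂ ⊆ Observer.good := by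
    rw [Observer.inducedMatrix, LinearMap.charpoly_toMatrix]
    exact hspec
  refine ⟨⟨fun ⟨E, F, h⟩ => ?_, fun h => ?_⟩,
    Observer.exists_mul_projMatrix_add_mul_eq_one C _ b,
    fun E F hEF => Observer.isUnknownInputObserver_of_eq_one B₁ hN hNP hPB hEF⟩
  · refine Observer.Wg_inf_ker_eq_bot A B₁ B₂ C L _ _ E F hNP hPB (fun w hw => ?_) h
    have hw0 : (Observer.Wg A B₂ C).mkQ w = 0 := (Submodule.Quotient.mk_eq_zero _).2 hw
    rw [Observer.projMatrix_mulVec, hw0, map_zero]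
  · obtain ⟨E, F, hEF⟩ := Observer.exists_mul_projMatrix_add_mul_eq_one C _ b h
    exact ⟨E, F, Observer.isUnknownInputObserver_of_eq_one B₁ hN hNP hPB hEF⟩
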